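/- Consider a single-server FCFS Markovian queue with Poisson arrivals of rate $\lambda>0$ and service rate $\mu_m$ when $m$ customers are present, where $(\mu_m)_{m\ge 0}$ is nondecreasing, $\mu_1>0$ and $\lim_{m\to\infty}\mu_m=M<\infty$. A customer who joins receives a reward $R\ge 0$ upon service completion and pays a waiting cost $C>0$ per unit of time in the system; put $\tilde R=R/C$. A strategy is a sequence $p=(p_n)_{n\ge 0}$ in $[0,1]$, where $p_n$ is the probability that an arriving customer who finds $n$ customers joins. Let $W(n,m;p)$ be the expected remaining time in the system of a tagged customer who has $n$ customers in front of her when there are $m>n$ customers in the system in total and all future arrivals follow $p$: that is, the expected absorption time, from state $(n,m)$, of the Markov chain with transitions $(n,m)\to(n,m+1)$ at rate $\lambda p_m$, $(n,m)\to(n-1,m-1)$ at rate $\mu_m$ if $n\ge1$, and $(0,m)\to$ departure at rate $\mu_m$. Let $W(n;p)=W(n,n+1;p)$ be the expected sojourn time of a customer who finds $n$ customers and joins. A strategy $p$ is a recurrent-class equilibrium if $n_0(p)=\min\{n:p_n=0\}$ exists and, for every $n\le n_0(p)$: $\tilde R\le W(n;p)$ if $p_n=0$; $\tilde R\ge W(n;p)$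 if $p_n=1$; and $\tilde R=W(n;p)$ if $0<p_n<1$. Let $x>0$ be a real number that is not an integer, and let $\hat p(x)$ be the mixed threshold strategy with $\hat p_n(x)=1$ for $n<\lfloor x\rfloor$, $\hat p_{\lfloor x\rfloor}(x)=x-\lfloor x\rfloor\in(0,1)$, and $\hat p_n(x)=0$ for $n>\lfloor x\rfloor$. Then $\hat p(x)$ is a recurrent-class equilibrium if and only if $$W\bigl(\lfloor x\rfloor,\lfloor x\rfloor+1;\hat p(x)\bigr)=\tilde R .$$ -/

import Mathlib

open MeasureTheory ProbabilityTheory Filter Topology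
open scoped ENNReal

namespace ObservableQueue

noncomputable section

/-- A (mixed, symmetric) joining strategy: `p n` is the probability with which an arriving
customer who finds `n` customers in the system joins. This is the set `Π = [0,1]^∞`. -/
abbrev Strategy : Type := ℕ → unitInterval

/-! ### The Markov chain followed by a tagged customer

The state is `some (n, m)` while the tagged customer is in the system, with `n` customers in
front of her and `m` customers in total, and `none` after her departure.
When the others use strategy `p`, the chain has the following transition rates:
* from `some (n, m)` to `some (n, m + 1)` at rate `lam * p m` (somebody joins behind her);
* from `some (n + 1, m)` to `some (n, m - 1)` at rate `μ m` (a service completion);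
* from `some (0, m)` to `none` at rate `μ m` (her own service completion).

It is constructed from its embedded jump chain and its exponential holding times. -/

/-- State space of the tagged customer's chain. -/
abbrev TaggedState : Type := Option (ℕ × ℕ)

/-- Total rate out of a state with `m` customers in the system. -/
def exitRate (lam : ℝ) (μ : ℕ → ℝ) (p : Strategy) (m : ℕ) : ℝ :=
  lam * (p m : ℝ) + μ m

/-- The jump out of a state, driven by a number `u` that is uniform on `[0,1]`: an arrival joins
with probability `lam * p m / (lam * p m + μ m)`, otherwise a service is completed. -/
def jump (lam : ℝ) (μ : ℕ → ℝ) (p : Strategy) (u : unitInterval) : TaggedState → TaggedState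
  | none => none
  | some (n, m) =>
      open Classical in
      if (u : ℝ) * exitRate lam μ p m < lam * (p m : ℝ) then some (n, m + 1)
      else if n = 0 then none
      else some (n - 1, m - 1)

/-- The time spent in a state, driven by `e` that is exponential with mean one; the result is
exponential with parameter `exitRate lam μ p m`. Time after the departure is not counted. -/
def holdingTime (lam : ℝ) (μ : ℕ → ℝ) (p : Strategy) (e : ℝ) : TaggedState → ℝ≥0∞
  | none => 0
  | some (_, m) => ENNReal.ofReal (e / exitRate lam μ p m)

/-- Sample space of the driving sequence: for each step an exponential and a uniform variable. -/
abbrev Sample : Type := ℕ → ℝ × unitInterval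

instance : IsProbabilityMeasure (expMeasure 1) := isProbabilityMeasure_expMeasure one_pos

/-- The law of the driving sequence: all coordinates are independent, the first components are
exponential with mean one and the second components are uniform on `[0,1]`. -/
def sampleLaw : Measure Sample :=
  Measure.infinitePi fun _ : ℕ => (expMeasure 1).prod (volume : Measure unitInterval)

/-- The state of the tagged customer's chain after `k` jumps, starting from `s`. -/
def path (lam : ℝ) (μ : ℕ → ℝ) (p : Strategy) (s : TaggedState) (ω : Sample) : ℕ → TaggedState
  | 0 => s
  | k + 1 => jump lam μ p (ω k).2 (path lam μ p s ω k)

/-- The total time until the departure of the tagged customer, starting from `s`. -/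
def timeToDeparture (lam : ℝ) (μ : ℕ → ℝ) (p : Strategy) (s : TaggedState) (ω : Sample) : ℝ≥0∞ :=
  ∑' k : ℕ, holdingTime lam μ p (ω k).1 (path lam μ p s ω k)

/-- The generalized waiting time `W(n, m; p)`: the expected remaining time in the system of a
tagged customer with `n` customers in front of her and `m` customers in total in the system,
when all future arrivals follow strategy `p`. -/
def W (lam : ℝ) (μ : ℕ → ℝ) (p : Strategy) (n m : ℕ) : ℝ≥0∞ :=
  ∫⁻ ω, timeToDeparture lam μ p (some (n, m)) ω ∂sampleLaw

/-- The delay function `W(n; p)`: the expected sojourn time of a customer who finds `n` customers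
upon arrival and joins (so that there are then `n + 1` customers in the system), while all other
customers follow `p`. If `p` prescribes balking at `n` and at `n + 1`, this customer is still
served, and nobody joins before the next service completion, which occurs at rate `μ (n + 1)`. -/
def delay (lam : ℝ) (μ : ℕ → ℝ) (p : Strategy) (n : ℕ) : ℝ≥0∞ :=
  W lam μ p n (n + 1)

/-! ### Equilibria in the recurrent class -/

/-- The strategies under which balking is prescribed at some finite state. -/
def finiteBalking : Set Strategy := {p | ∃ n, p n = 0}

/-- `n₀(p) = min {n : p n = 0}`, for a strategy `p` in `finiteBalking`; the states
`0, …, n₀(p)` are then the recurrent ones. -/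
def balkingState (p : Strategy) : ℕ := sInf {n | p n = 0}

/-- The equilibrium conditions at state `n`, with normalized reward `r`: balking, joining, or
randomizing is a best response of a customer who finds `n` customers. -/
def EquilibriumAt (lam : ℝ) (μ : ℕ → ℝ) (r : ℝ) (p : Strategy) (n : ℕ) : Prop :=
  (p n = 0 → ENNReal.ofReal r ≤ delay lam μ p n) ∧
  (p n = 1 → delay lam μ p n ≤ ENNReal.ofReal r) ∧
  (0 < p n ∧ p n < 1 → delay lam μ p n = ENNReal.ofReal r)

/-- The set of recurrent class equilibria for the normalized reward `r`. -/
def recurrentClassEquilibria (lam : ℝ) (μ : ℕ → ℝ) (r : ℝ) : Set Strategy :=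
  {p | p ∈ finiteBalking ∧ ∀ n ≤ balkingState p, EquilibriumAt lam μ r p n}

/-! ### Mixed threshold strategies -/

/-- The threshold strategy determined by `x > 0`: join below `⌊x⌋`, join with probability
`x - ⌊x⌋` at `⌊x⌋`, and balk above `⌊x⌋`. -/
def mixedThreshold (x : ℝ) : Strategy := fun n =>
  if n < ⌊x⌋₊ then 1
  else if n = ⌊x⌋₊ then ⟨Int.fract x, Int.fract_nonneg x, (Int.fract_lt_one x).le⟩
  else 0

/-- The set of all threshold strategies, pure (`x` an integer) or mixed. -/
def mixedThresholdStrategies : Set Strategy := {p | ∃ x : ℝ, 0 < x ∧ p = mixedThreshold x}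

/-- The threshold strategies that are recurrent class equilibria. -/
def mixedThresholdEquilibria (lam : ℝ) (μ : ℕ → ℝ) (r : ℝ) : Set Strategy :=
  recurrentClassEquilibria lam μ r ∩ mixedThresholdStrategies

end

end ObservableQueue

/-! Only the state `⌊x⌋` is randomized, so the equilibrium condition there is the asserted equality;
this gives necessity. For sufficiency it is enough that the delay is nondecreasing in the number of
customers found: joining is then optimal below `⌊x⌋` and balking above it.

Monotonicity comes from a coupling, carried out analytically. `W` is the least solution of its
first-step inequalities (`W_first_step`, `W_le_of_first_step_le`) and hence the least fixed point of
the operator uniformized at rate `lam + M` (`W_eq_lfp_uniformized`). Fixed-point induction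
(`lfp_uniformized_monotone`) then propagates two inequalities at once, because the comparison of
systems of different size also needs the comparison of two positions in systems of equal size. All
values lie in `ℝ≥0∞`, so finiteness of `W` is never needed. -/

namespace ObservableQueue

/-! ### Markov property of the tagged customer's chain -/

/-- The driving sequence that starts with `a` and continues with `ω`. -/
def consSample (a : ℝ × unitInterval) (ω : Sample) : Sample
  | 0 => a
  | k + 1 => ω k

theorem measurable_consSample :
    Measurable fun q : (ℝ × unitInterval) × Sample => consSample q.1 q.2 := by
  refine measurable_pi_lambda _ fun k => ?_
  cases k with
  | zero => exact measurable_fst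
  | succ k => exact (measurable_pi_apply k).comp measurable_snd

instance : IsProbabilityMeasure sampleLaw := by
  unfold sampleLaw; infer_instance

/-- The driving sequence is i.i.d., so prepending an independent step leaves its law unchanged. This
is what yields the Markov property at the first jump. -/
theorem map_consSample :
    (((expMeasure 1).prod (volume : Measure unitInterval)).prod sampleLaw).map
      (fun q => consSample q.1 q.2) = sampleLaw := by
  refine Measure.eq_infinitePi _ fun s t ht => ?_
  rw [Measure.map_apply measurable_consSample
    (MeasurableSet.pi s.countable_toSet fun i _ => ht i)]
  set P := (expMeasure 1).prod (volume : Measure unitInterval)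
  set s' : Finset ℕ := s.preimage Nat.succ (Nat.succ_injective.injOn)
  -- A cylinder pulls back to a rectangle: coordinate 0 constrains the new step, and the others,
  -- shifted by one, constrain the old sequence.
  have hset : (fun q : (ℝ × unitInterval) × Sample => consSample q.1 q.2) ⁻¹' ((s : Set ℕ).pi t)
      = (if 0 ∈ s then t 0 else Set.univ) ×ˢ ((s' : Set ℕ).pi fun i => t (i + 1)) := by
    ext ⟨a, ω⟩
    simp only [Set.mem_preimage, Set.mem_pi, Finset.mem_coe, Set.mem_prod, s',
      Finset.mem_preimage]
    constructor
    · intro h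
      refine ⟨?_, fun i hi => h (i + 1) hi⟩
      split_ifs with h0
      · exact h 0 h0
      · trivial
    · rintro ⟨h0, h1⟩ i hi
      cases i with
      | zero => rw [if_pos hi] at h0; exact h0
      | succ i => exact h1 i hi
  rw [hset, Measure.prod_prod]
  unfold sampleLaw
  rw [Measure.infinitePi_pi _ (fun i _ => ht (i + 1))]
  by_cases h0 : 0 ∈ s
  · have hs : s = insert 0 (s'.map ⟨Nat.succ, Nat.succ_injective⟩) := by
      ext i
      cases i <;> simp [s', h0]
    rw [if_pos h0]
    conv_rhs => rw [hs]
    rw [Finset.prod_insert (by simp), Finset.prod_map]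
    rfl
  · have hs : s = s'.map ⟨Nat.succ, Nat.succ_injective⟩ := by
      ext i
      cases i <;> simp [s', h0]
    rw [if_neg h0, measure_univ, one_mul]
    conv_rhs => rw [hs]
    rw [Finset.prod_map]
    rfl

section Chain

variable (lam : ℝ) (μ : ℕ → ℝ) (p : Strategy)

local instance taggedMeasurableSpace : MeasurableSpace TaggedState := ⊤

theorem measurable_jump :
    Measurable fun q : unitInterval × TaggedState => jump lam μ p q.1 q.2 := by
  refine measurable_from_prod_countable_left fun s => ?_
  match s with
  | none => exact measurable_const
  | some (n, m) =>
    simp only [jump]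
    refine Measurable.ite ?_ measurable_const measurable_const
    exact measurableSet_lt (measurable_subtype_coe.mul_const _) measurable_const

theorem measurable_path (s : TaggedState) (k : ℕ) :
    Measurable fun ω => path lam μ p s ω k := by
  induction k with
  | zero => exact measurable_const
  | succ k ih =>
    exact (measurable_jump lam μ p).comp
      ((measurable_snd.comp (measurable_pi_apply k)).prodMk ih)

theorem measurable_holdingTime :
    Measurable fun q : ℝ × TaggedState => holdingTime lam μ p q.1 q.2 := by
  refine measurable_from_prod_countable_left fun s => ?_
  match s with
  | none => exact measurable_const
  | some (n, m) =>
    simp only [holdingTime]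
    fun_prop

theorem measurable_step (s : TaggedState) (k : ℕ) :
    Measurable fun ω : Sample => holdingTime lam μ p (ω k).1 (path lam μ p s ω k) :=
  (measurable_holdingTime lam μ p).comp
    ((measurable_fst.comp (measurable_pi_apply k)).prodMk (measurable_path lam μ p s k))

theorem path_consSample (s : TaggedState) (a : ℝ × unitInterval) (ω : Sample) (k : ℕ) :
    path lam μ p s (consSample a ω) (k + 1) = path lam μ p (jump lam μ p a.2 s) ω k := by
  induction k with
  | zero => rfl
  | succ k ih =>
    rw [path, ih]
    rfl

/-- The expected time spent in the state reached after `k` jumps. -/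
noncomputable def meanHolding (k : ℕ) (s : TaggedState) : ℝ≥0∞ :=
  ∫⁻ ω, holdingTime lam μ p (ω k).1 (path lam μ p s ω k) ∂sampleLaw

theorem meanHolding_zero (s : TaggedState) :
    meanHolding lam μ p 0 s = ∫⁻ e, holdingTime lam μ p e s ∂(expMeasure 1) := by
  have h1 : MeasurePreserving (fun ω : Sample => (ω 0).1) sampleLaw (expMeasure 1) :=
    measurePreserving_fst.comp (measurePreserving_eval_infinitePi _ 0)
  exact h1.lintegral_comp (f := fun e => holdingTime lam μ p e s)
    ((measurable_holdingTime lam μ p).comp (measurable_id.prodMk measurable_const))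

theorem meanHolding_succ (k : ℕ) (s : TaggedState) :
    meanHolding lam μ p (k + 1) s
      = ∫⁻ u : unitInterval, meanHolding lam μ p k (jump lam μ p u s) := by
  have hm := measurable_step lam μ p s (k + 1)
  have hj : Measurable fun u : unitInterval => meanHolding lam μ p k (jump lam μ p u s) :=
    (measurable_from_top (f := meanHolding lam μ p k)).comp
      ((measurable_jump lam μ p).comp (measurable_id.prodMk measurable_const))
  rw [meanHolding, ← map_consSample, lintegral_map hm measurable_consSample,
    lintegral_prod (fun q : (ℝ × unitInterval) × Sample =>
      holdingTime lam μ p (consSample q.1 q.2 (k + 1)).1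
        (path lam μ p s (consSample q.1 q.2) (k + 1)))
      (hm.comp measurable_consSample).aemeasurable,
    ← measurePreserving_snd.lintegral_comp (μ := (expMeasure 1).prod volume) hj]
  refine lintegral_congr fun a => ?_
  simp only [path_consSample]
  rfl

theorem W_eq_tsum (n m : ℕ) :
    W lam μ p n m = ∑' k, meanHolding lam μ p k (some (n, m)) := by
  unfold W timeToDeparture
  exact lintegral_tsum fun k => (measurable_step lam μ p _ k).aemeasurable

theorem meanHolding_none (k : ℕ) : meanHolding lam μ p k none = 0 := by
  induction k with
  | zero => simp [meanHolding_zero, holdingTime]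
  | succ k ih => simp [meanHolding_succ, jump, ih]

end Chain

/-! ### First-step equations and minimality of the waiting time -/

/-- The value after a service completion: the tagged customer leaves if nobody is in front of
her, and otherwise moves one place forward. Here `F n d` belongs to a customer with `n` others in
front of her and `d` behind her. -/
def afterService (F : ℕ → ℕ → ℝ≥0∞) : ℕ → ℕ → ℝ≥0∞
  | 0, _ => 0
  | n + 1, d => F n d

theorem afterService_mono {F G : ℕ → ℕ → ℝ≥0∞} (h : ∀ n d, F n d ≤ G n d) (n d : ℕ) :
    afterService F n d ≤ afterService G n d := by
  cases n with
  | zero => exact le_rfl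
  | succ n => exact h n d

variable {lam : ℝ} {μ : ℕ → ℝ} {p : Strategy}

/-- An arrival occurs exactly when the uniform variable lies below the arrival probability `y`, so
the integral splits over `Iio y` and `Ici y`. Since `G none = 0`, departure agrees with
`afterService` at `n = 0`. -/
theorem lintegral_jump (G : TaggedState → ℝ≥0∞) (hG : G none = 0) (n d : ℕ)
    (ha : 0 ≤ lam * p (n + 1 + d)) (hb : 0 < μ (n + 1 + d)) :
    ∫⁻ u : unitInterval, G (jump lam μ p u (some (n, n + 1 + d)))
      = ENNReal.ofReal (lam * p (n + 1 + d) / exitRate lam μ p (n + 1 + d))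
          * G (some (n, n + 1 + (d + 1)))
        + ENNReal.ofReal (μ (n + 1 + d) / exitRate lam μ p (n + 1 + d))
          * afterService (fun n d => G (some (n, n + 1 + d))) n d := by
  set m := n + 1 + d with hm
  have hr : 0 < exitRate lam μ p m := by unfold exitRate; linarith
  set y : unitInterval := ⟨lam * p m / exitRate lam μ p m, by positivity, by
    rw [div_le_one hr]; unfold exitRate; linarith⟩ with hy
  have hjump : ∀ u : unitInterval, G (jump lam μ p u (some (n, m)))
      = (Set.Iio y).indicator (fun _ => G (some (n, n + 1 + (d + 1)))) u
        + (Set.Ici y).indicator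
          (fun _ => afterService (fun n d => G (some (n, n + 1 + d))) n d) u := by
    intro u
    have hlt : (u : ℝ) * exitRate lam μ p m < lam * p m ↔ u < y := by
      rw [← Subtype.coe_lt_coe, hy, lt_div_iff₀ hr]
    rw [jump]
    by_cases hu : u < y
    · rw [if_pos (hlt.2 hu), Set.indicator_of_mem (Set.mem_Iio.2 hu),
        Set.indicator_of_notMem (fun h => (Set.mem_Ici.1 h).not_gt hu), add_zero]
      rfl
    · rw [if_neg (hlt.not.2 hu), Set.indicator_of_notMem (fun h => hu (Set.mem_Iio.1 h)),
        Set.indicator_of_mem (Set.mem_Ici.2 (not_lt.1 hu)), zero_add]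
      cases n with
      | zero => rw [if_pos rfl, hG, afterService]
      | succ n =>
        rw [if_neg n.succ_ne_zero, afterService, Nat.add_sub_cancel,
          show m - 1 = n + 1 + d by omega]
  simp_rw [hjump]
  rw [lintegral_add_left (measurable_const.indicator measurableSet_Iio),
    lintegral_indicator_const measurableSet_Iio, lintegral_indicator_const measurableSet_Ici,
    unitInterval.volume_Iio, unitInterval.volume_Ici, mul_comm, mul_comm _ (ENNReal.ofReal _)]
  congr 3
  rw [hy]
  simp only
  rw [eq_div_iff hr.ne', sub_mul, div_mul_cancel₀ _ hr.ne']
  unfold exitRate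
  ring

/-- The mean of the exponential clock that drives the holding times. -/
noncomputable def meanClock : ℝ≥0∞ := ∫⁻ e, ENNReal.ofReal e ∂(expMeasure 1)

theorem meanHolding_zero_some (n m : ℕ) (hr : 0 < exitRate lam μ p m) :
    meanHolding lam μ p 0 (some (n, m))
      = meanClock * ENNReal.ofReal (exitRate lam μ p m)⁻¹ := by
  rw [meanHolding_zero, meanClock, ← lintegral_mul_const _ ENNReal.measurable_ofReal]
  refine lintegral_congr fun e => ?_
  rw [holdingTime, div_eq_mul_inv, ENNReal.ofReal_mul' (by positivity)]

/-- First-step analysis of the waiting time. -/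
theorem W_first_step (n d : ℕ) (ha : 0 ≤ lam * p (n + 1 + d)) (hb : 0 < μ (n + 1 + d)) :
    W lam μ p n (n + 1 + d)
      = meanClock * ENNReal.ofReal (exitRate lam μ p (n + 1 + d))⁻¹
        + (ENNReal.ofReal (lam * p (n + 1 + d) / exitRate lam μ p (n + 1 + d))
            * W lam μ p n (n + 1 + (d + 1))
          + ENNReal.ofReal (μ (n + 1 + d) / exitRate lam μ p (n + 1 + d))
            * afterService (fun n d => W lam μ p n (n + 1 + d)) n d) := by
  have hr : 0 < exitRate lam μ p (n + 1 + d) := by unfold exitRate; linarith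
  have hserv : afterService (fun n d => W lam μ p n (n + 1 + d)) n d
      = ∑' k, afterService (fun n d => meanHolding lam μ p k (some (n, n + 1 + d))) n d := by
    cases n with
    | zero => simp [afterService]
    | succ n => exact W_eq_tsum lam μ p _ _
  rw [W_eq_tsum, tsum_eq_zero_add' ENNReal.summable, meanHolding_zero_some _ _ hr, hserv, W_eq_tsum,
    ← ENNReal.tsum_mul_left, ← ENNReal.tsum_mul_left, ← ENNReal.tsum_add]
  congr 2
  ext k
  rw [meanHolding_succ, lintegral_jump _ (meanHolding_none lam μ p k) n d ha hb]

/-- The waiting time is the least solution of the first-step inequalities. -/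
theorem W_le_of_first_step_le (ha : ∀ m, 0 ≤ lam * p m) (hb : ∀ m, 0 < μ (m + 1))
    (F : ℕ → ℕ → ℝ≥0∞)
    (hF : ∀ n d, meanClock * ENNReal.ofReal (exitRate lam μ p (n + 1 + d))⁻¹
        + (ENNReal.ofReal (lam * p (n + 1 + d) / exitRate lam μ p (n + 1 + d)) * F n (d + 1)
          + ENNReal.ofReal (μ (n + 1 + d) / exitRate lam μ p (n + 1 + d))
            * afterService F n d) ≤ F n d) (n d : ℕ) :
    W lam μ p n (n + 1 + d) ≤ F n d := by
  have hb' : ∀ n d, 0 < μ (n + 1 + d) := fun n d => by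
    have := hb (n + d); rwa [show n + d + 1 = n + 1 + d by omega] at this
  -- The cost of the first `N` jumps stays below every supersolution, by induction on `N`; `W` is
  -- the supremum of these costs.
  have key : ∀ N n d,
      ∑ k ∈ Finset.range N, meanHolding lam μ p k (some (n, n + 1 + d)) ≤ F n d := by
    intro N
    induction N with
    | zero => intro n d; simp
    | succ N ih =>
      intro n d
      have hr : 0 < exitRate lam μ p (n + 1 + d) := by
        unfold exitRate; linarith [ha (n + 1 + d), hb' n d]
      have hserv : ∑ k ∈ Finset.range N,
          afterService (fun n d => meanHolding lam μ p k (some (n, n + 1 + d))) n d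
          ≤ afterService F n d := by
        cases n with
        | zero => simp [afterService]
        | succ n => exact ih n d
      refine le_trans ?_ (hF n d)
      rw [Finset.sum_range_succ', meanHolding_zero_some _ _ hr, add_comm]
      simp_rw [meanHolding_succ,
        fun k => lintegral_jump _ (meanHolding_none lam μ p k) n d (ha _) (hb' n d)]
      rw [Finset.sum_add_distrib, ← Finset.mul_sum, ← Finset.mul_sum]
      gcongr
      exact ih n (d + 1)
  rw [W_eq_tsum, ENNReal.tsum_eq_iSup_nat]
  exact iSup_le fun N => key N n d

end ObservableQueue

namespace ObservableQueue

open scoped NNReal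

/-! ### The uniformized chain -/

/-- The first-step operator of the uniformized chain: in a state with `m` customers an arrival has
probability `α m`, a service completion `β m`, and nothing happens with probability `σ m`; each
step costs `c`. -/
noncomputable def uniformized (c : ℝ≥0∞) (α β σ : ℕ → ℝ≥0) :
    (ℕ → ℕ → ℝ≥0∞) →o (ℕ → ℕ → ℝ≥0∞) where
  toFun F n d := c + (α (n + 1 + d) * F n (d + 1) + β (n + 1 + d) * afterService F n d
    + σ (n + 1 + d) * F n d)
  monotone' F G h n d := by
    have h' : ∀ n d, F n d ≤ G n d := h
    have := afterService_mono h' n d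
    dsimp only
    gcongr
    · exact h' _ _
    · exact h' _ _

/-- Pathwise coupling, at the level of the first-step equations: a customer further back in a
system that is at least as full waits longer. -/
theorem lfp_uniformized_monotone (c : ℝ≥0∞) {α β σ : ℕ → ℝ≥0}
    (hα : ∀ m, α (m + 1 + 1) ≤ α (m + 1)) (hβ : ∀ m, β (m + 1) ≤ β (m + 1 + 1))
    (hsum : ∀ m, α (m + 1) + β (m + 1) + σ (m + 1) = 1)
    (hle : ∀ m, α (m + 1) + β (m + 1 + 1) ≤ 1) :
    ∀ n d, (uniformized c α β σ).lfp n d ≤ (uniformized c α β σ).lfp (n + 1) d ∧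
      (uniformized c α β σ).lfp n (d + 1) ≤ (uniformized c α β σ).lfp (n + 1) d := by
  refine OrderHom.lfp_induction (uniformized c α β σ)
    (p := fun F => ∀ n d, F n d ≤ F (n + 1) d ∧ F n (d + 1) ≤ F (n + 1) d) ?_ ?_
  · intro F hF _ n d
    have hserv : ∀ d, afterService F n d ≤ F n d := by
      intro d
      cases n with
      | zero => exact zero_le
      | succ n => exact (hF n d).1
    have hserv' : afterService F n (d + 1) ≤ F n d := by
      cases n with
      | zero => exact zero_le
      | succ n => exact (hF n d).2
    constructor
    -- Coupling of a system with one that has one more customer in front: `δ` is an arrival in the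
    -- smaller system only, `ε` a service in the larger only (after which the states coincide), and
    -- `ρ` leaves both unchanged. The event `δ` is where the second inequality enters.
    · obtain ⟨δ, hδ⟩ := le_iff_exists_add.1 (hα (n + d))
      obtain ⟨ε, hε⟩ := le_iff_exists_add.1 (hβ (n + d))
      obtain ⟨ρ, hρ⟩ := le_iff_exists_add.1 (hle (n + d))
      have hσ : σ (n + d + 1) = ρ + ε := by
        have h1 := hsum (n + d)
        rw [hρ, hε] at h1
        refine add_left_cancel (a := α (n + d + 1) + β (n + d + 1)) (h1.trans ?_)
        ring
      have hσ' : σ (n + d + 1 + 1) = ρ + δ := by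
        have h1 := hsum (n + d + 1)
        rw [hρ, hδ] at h1
        refine add_left_cancel (a := α (n + d + 1 + 1) + β (n + d + 1 + 1)) (h1.trans ?_)
        ring
      have e1 : n + 1 + d = n + d + 1 := by omega
      have e2 : n + 1 + 1 + d = n + d + 1 + 1 := by omega
      change c + (α (n + 1 + d) * F n (d + 1) + β (n + 1 + d) * afterService F n d
        + σ (n + 1 + d) * F n d) ≤ c + (α (n + 1 + 1 + d) * F (n + 1) (d + 1)
        + β (n + 1 + 1 + d) * F n d + σ (n + 1 + 1 + d) * F (n + 1) d)
      rw [e1, e2, hσ, hσ', hδ, hε]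
      push_cast
      calc c + ((α (n + d + 1 + 1) + δ : ℝ≥0∞) * F n (d + 1)
              + β (n + d + 1) * afterService F n d + (ρ + ε : ℝ≥0∞) * F n d)
          = c + (α (n + d + 1 + 1) * F n (d + 1) + β (n + d + 1) * afterService F n d
              + ε * F n d + ρ * F n d + δ * F n (d + 1)) := by ring
        _ ≤ c + (α (n + d + 1 + 1) * F (n + 1) (d + 1) + β (n + d + 1) * F n d
              + ε * F n d + ρ * F (n + 1) d + δ * F (n + 1) d) := by
            gcongr
            · exact (hF n (d + 1)).1
            · exact hserv d
            · exact (hF n d).1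
            · exact (hF n d).2
        _ = _ := by ring
    · have e : n + 1 + (d + 1) = n + 1 + 1 + d := by omega
      change c + (α (n + 1 + (d + 1)) * F n (d + 1 + 1)
        + β (n + 1 + (d + 1)) * afterService F n (d + 1)
        + σ (n + 1 + (d + 1)) * F n (d + 1)) ≤ c + (α (n + 1 + 1 + d) * F (n + 1) (d + 1)
        + β (n + 1 + 1 + d) * F n d + σ (n + 1 + 1 + d) * F (n + 1) d)
      rw [e]
      gcongr
      · exact (hF n (d + 1)).2
      · exact (hF n d).2
  · intro s hs n d
    have hmono : ∀ i j k l, (∀ F ∈ s, F i j ≤ F k l) → sSup s i j ≤ sSup s k l := by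
      intro i j k l h
      simp only [sSup_apply, iSup_apply]
      exact iSup_mono fun F => h F.1 F.2
    exact ⟨hmono _ _ _ _ fun F hF => (hs F hF n d).1, hmono _ _ _ _ fun F hF => (hs F hF n d).2⟩

/-- The uniformized first step makes the first step of the original chain with probability
`(a + b) / L`, and otherwise does nothing. -/
theorem uniformized_step_eq {L a b : ℝ} (hL : 0 < L) (ha : 0 ≤ a) (hb : 0 < b)
    (c u v w : ℝ≥0∞) :
    c * ENNReal.ofReal L⁻¹ + (ENNReal.ofReal (a / L) * u + ENNReal.ofReal (b / L) * v
      + ENNReal.ofReal ((L - a - b) / L) * w)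
    = ENNReal.ofReal ((a + b) / L) * (c * ENNReal.ofReal (a + b)⁻¹
        + (ENNReal.ofReal (a / (a + b)) * u + ENNReal.ofReal (b / (a + b)) * v))
      + ENNReal.ofReal ((L - a - b) / L) * w := by
  have hr : 0 < a + b := by linarith
  have h : ∀ t, ENNReal.ofReal ((a + b) / L * t)
      = ENNReal.ofReal ((a + b) / L) * ENNReal.ofReal t := fun t =>
    ENNReal.ofReal_mul (by positivity)
  have h1 : L⁻¹ = (a + b) / L * (a + b)⁻¹ := by field_simp
  have h2 : a / L = (a + b) / L * (a / (a + b)) := by field_simp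
  have h3 : b / L = (a + b) / L * (b / (a + b)) := by field_simp
  rw [h1, h2, h3, h, h, h]
  ring

theorem ofReal_div_add_ofReal_div_eq_one {L a b : ℝ} (hL : 0 < L) (ha : 0 ≤ a) (hb : 0 < b)
    (hab : a + b ≤ L) :
    ENNReal.ofReal ((a + b) / L) + ENNReal.ofReal ((L - a - b) / L) = 1 := by
  rw [← ENNReal.ofReal_add (by positivity) (div_nonneg (by linarith) hL.le),
    ← ENNReal.ofReal_one]
  congr 1
  field_simp
  ring

/-- A solution of the first-step equation solves the uniformized equation. -/
theorem uniformized_step_of_first_step {L a b : ℝ} (hL : 0 < L) (ha : 0 ≤ a) (hb : 0 < b)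
    (hab : a + b ≤ L) (c w : ℝ≥0∞) {u v : ℝ≥0∞}
    (hw : w = c * ENNReal.ofReal (a + b)⁻¹
      + (ENNReal.ofReal (a / (a + b)) * u + ENNReal.ofReal (b / (a + b)) * v)) :
    c * ENNReal.ofReal L⁻¹ + (ENNReal.ofReal (a / L) * u + ENNReal.ofReal (b / L) * v
      + ENNReal.ofReal ((L - a - b) / L) * w) = w := by
  rw [uniformized_step_eq hL ha hb, ← hw, ← add_mul,
    ofReal_div_add_ofReal_div_eq_one hL ha hb hab, one_mul]

/-- A supersolution of the uniformized equation is a supersolution of the first-step equation. -/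
theorem first_step_le_of_uniformized_le {L a b : ℝ} (hL : 0 < L) (ha : 0 ≤ a) (hb : 0 < b)
    (hab : a + b ≤ L) {c u v w : ℝ≥0∞}
    (h : c * ENNReal.ofReal L⁻¹ + (ENNReal.ofReal (a / L) * u + ENNReal.ofReal (b / L) * v
      + ENNReal.ofReal ((L - a - b) / L) * w) ≤ w) :
    c * ENNReal.ofReal (a + b)⁻¹
      + (ENNReal.ofReal (a / (a + b)) * u + ENNReal.ofReal (b / (a + b)) * v) ≤ w := by
  -- Cancelling the idle term below requires `w` to be finite.
  rcases eq_or_ne w ⊤ with rfl | hw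
  · exact le_top
  have hθ : ENNReal.ofReal ((a + b) / L) ≠ 0 :=
    (ENNReal.ofReal_pos.2 (div_pos (by linarith) hL)).ne'
  rw [← ENNReal.mul_le_mul_iff_right hθ ENNReal.ofReal_ne_top]
  refine (ENNReal.add_le_add_iff_right (ENNReal.mul_ne_top ENNReal.ofReal_ne_top hw)).1
    ((uniformized_step_eq hL ha hb c u v w).symm.le.trans (h.trans (le_of_eq ?_)))
  rw [← add_mul, ofReal_div_add_ofReal_div_eq_one hL ha hb hab, one_mul]

end ObservableQueue

/-! ### Monotonicity of the delay -/

namespace ObservableQueue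

/-- The waiting time is the least fixed point of the uniformized first-step operator. -/
theorem W_eq_lfp_uniformized {lam L : ℝ} {μ : ℕ → ℝ} {p : Strategy} (hL : 0 < L)
    (ha : ∀ m, 0 ≤ lam * p m) (hb : ∀ m, 0 < μ (m + 1))
    (hab : ∀ m, lam * p (m + 1) + μ (m + 1) ≤ L) (n d : ℕ) :
    W lam μ p n (n + 1 + d)
      = (uniformized (meanClock * ENNReal.ofReal L⁻¹) (fun m => (lam * p m / L).toNNReal)
          (fun m => (μ m / L).toNNReal)
          (fun m => ((L - lam * p m - μ m) / L).toNNReal)).lfp n d := by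
  have hb' : ∀ n d, 0 < μ (n + 1 + d) := fun n d => by
    have := hb (n + d); rwa [show n + d + 1 = n + 1 + d by omega] at this
  have hab' : ∀ n d, lam * p (n + 1 + d) + μ (n + 1 + d) ≤ L := fun n d => by
    have := hab (n + d); rwa [show n + d + 1 = n + 1 + d by omega] at this
  set U := uniformized (meanClock * ENNReal.ofReal L⁻¹) (fun m => (lam * p m / L).toNNReal)
          (fun m => (μ m / L).toNNReal)
          (fun m => ((L - lam * p m - μ m) / L).toNNReal) with hU
  apply le_antisymm
  · refine W_le_of_first_step_le ha hb _ (fun n d => ?_) n d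
    exact first_step_le_of_uniformized_le hL (ha _) (hb' n d) (hab' n d)
      (congrFun (congrFun U.map_lfp n) d).le
  · refine OrderHom.lfp_le U (a := fun n d => W lam μ p n (n + 1 + d)) (fun n d => ?_) n d
    exact (uniformized_step_of_first_step hL (ha _) (hb' n d) (hab' n d) _ _
      (W_first_step n d (ha _) (hb' n d))).le

/-- If later customers are less inclined to join a fuller system, then the delay increases with
the number of customers found. -/
theorem delay_monotone {lam M : ℝ} {μ : ℕ → ℝ} {p : Strategy} (hlam : 0 < lam)
    (hμ : Monotone μ) (hμ_pos : 0 < μ 1) (hM : ∀ m, μ m ≤ M) (hp : Antitone p) :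
    Monotone (delay lam μ p) := by
  have ha : ∀ m, 0 ≤ lam * (p m : ℝ) := fun m => mul_nonneg hlam.le (p m).2.1
  have hb : ∀ m, 0 < μ (m + 1) := fun m => hμ_pos.trans_le (hμ (by omega))
  have ha' : ∀ m, lam * (p m : ℝ) ≤ lam := fun m => mul_le_of_le_one_right hlam.le (p m).2.2
  have hL : 0 < lam + M := by linarith [hM 1]
  -- Independent indices are needed: the coupling combines the arrival rate of one state with the
  -- service rate of the next.
  have hab : ∀ i j, lam * (p i : ℝ) + μ j ≤ lam + M := fun i j => add_le_add (ha' i) (hM j)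
  refine monotone_nat_of_le_succ fun n => ?_
  have key := fun k => W_eq_lfp_uniformized hL ha hb (fun m => hab _ _) k 0
  simp only [add_zero] at key
  rw [delay, delay, key, key]
  refine (lfp_uniformized_monotone _ ?_ ?_ ?_ ?_ n 0).1
  · intro m
    refine Real.toNNReal_le_toNNReal ?_
    have : (p (m + 1 + 1) : ℝ) ≤ p (m + 1) := hp (Nat.le_succ _)
    gcongr
  · intro m
    refine Real.toNNReal_le_toNNReal ?_
    have := hμ (Nat.le_succ (m + 1))
    gcongr
  · intro m
    have h1 := hab (m + 1) (m + 1)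
    have h2 := ha (m + 1)
    have h3 := hb m
    rw [← Real.toNNReal_add (by positivity) (by positivity),
      ← Real.toNNReal_add (by positivity) (div_nonneg (by linarith) hL.le), ← Real.toNNReal_one]
    congr 1
    field_simp
    ring
  · intro m
    have h1 := hab (m + 1) (m + 1 + 1)
    have h2 := ha (m + 1)
    have h3 := hb (m + 1)
    rw [← Real.toNNReal_add (by positivity) (by positivity), ← Real.toNNReal_one]
    refine Real.toNNReal_le_toNNReal ?_
    rw [← add_div, div_le_one hL]
    exact h1

/-! ### Mixed threshold strategies -/

theorem mixedThreshold_of_lt {x : ℝ} {n : ℕ} (h : n < ⌊x⌋₊) : mixedThreshold x n = 1 :=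
  if_pos h

theorem mixedThreshold_of_gt {x : ℝ} {n : ℕ} (h : ⌊x⌋₊ < n) : mixedThreshold x n = 0 := by
  rw [mixedThreshold, if_neg h.not_gt, if_neg h.ne']

theorem coe_mixedThreshold_floor (x : ℝ) : (mixedThreshold x ⌊x⌋₊ : ℝ) = Int.fract x := by
  simp [mixedThreshold]

theorem mixedThreshold_antitone (x : ℝ) : Antitone (mixedThreshold x) := by
  intro i j hij
  rcases lt_or_ge i ⌊x⌋₊ with hi | hi
  · rw [mixedThreshold_of_lt hi]
    exact unitInterval.le_one'
  rcases hij.eq_or_lt with rfl | hij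
  · exact le_rfl
  · rw [mixedThreshold_of_gt (hi.trans_lt hij)]
    exact unitInterval.nonneg'

theorem mixedThreshold_floor_mem_Ioo {x : ℝ} (hx : Int.fract x ≠ 0) :
    0 < mixedThreshold x ⌊x⌋₊ ∧ mixedThreshold x ⌊x⌋₊ < 1 := by
  rw [← Subtype.coe_lt_coe, ← Subtype.coe_lt_coe, coe_mixedThreshold_floor]
  exact ⟨(Int.fract_nonneg x).lt_of_ne' hx, Int.fract_lt_one x⟩

theorem balkingState_mixedThreshold {x : ℝ} (hx : Int.fract x ≠ 0) :
    balkingState (mixedThreshold x) = ⌊x⌋₊ + 1 := by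
  have hmem : ⌊x⌋₊ + 1 ∈ {n | mixedThreshold x n = 0} := mixedThreshold_of_gt (Nat.lt_succ_self _)
  refine le_antisymm (Nat.sInf_le hmem) (le_csInf ⟨_, hmem⟩ fun n hn => ?_)
  by_contra! hlt
  have := mixedThreshold_antitone x (Nat.le_of_lt_succ hlt)
  rw [show mixedThreshold x n = 0 from hn] at this
  exact (mixedThreshold_floor_mem_Ioo hx).1.not_ge this

end ObservableQueue

theorem theorem2
    -- arrival rate, nondecreasing service rates with finite limit
    (lam : ℝ) (hlam : 0 < lam)
    (μ : ℕ → ℝ) (hμ_mono : Monotone μ) (hμ_pos : 0 < μ 1)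
    (M : ℝ) (hM : Tendsto μ atTop (𝓝 M))
    -- service reward and waiting cost per time unit
    (R C : ℝ) (hR : 0 ≤ R) (hC : 0 < C)
    -- the real number that determines the strategy, with `x - ⌊x⌋ ∈ (0,1)`
    (x : ℝ) (hx : 0 < x) (hx_fract : Int.fract x ≠ 0) :
    ObservableQueue.mixedThreshold x ∈ ObservableQueue.mixedThresholdEquilibria lam μ (R / C) ↔
      ObservableQueue.W lam μ (ObservableQueue.mixedThreshold x) ⌊x⌋₊ (⌊x⌋₊ + 1)
        = ENNReal.ofReal (R / C) := by
  open ObservableQueue in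
  have hmid := mixedThreshold_floor_mem_Ioo hx_fract
  have hbalk := balkingState_mixedThreshold hx_fract
  constructor
  · rintro ⟨⟨-, h⟩, -⟩
    exact (h ⌊x⌋₊ (by omega)).2.2 hmid
  · intro hW
    have hmono : Monotone (delay lam μ (mixedThreshold x)) :=
      delay_monotone hlam hμ_mono hμ_pos (fun m => hμ_mono.ge_of_tendsto hM m)
        (mixedThreshold_antitone x)
    have hW' : delay lam μ (mixedThreshold x) ⌊x⌋₊ = ENNReal.ofReal (R / C) := hW
    -- The equilibrium conditions are verified at every `n`, not only up to the balking state.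
    refine ⟨⟨⟨⌊x⌋₊ + 1, mixedThreshold_of_gt (Nat.lt_succ_self _)⟩, fun n _ => ?_⟩, x, hx, rfl⟩
    rcases lt_trichotomy n ⌊x⌋₊ with h | rfl | h
    · have h1 := mixedThreshold_of_lt h
      refine ⟨fun h0 => ?_, fun _ => hW' ▸ hmono h.le, fun h2 => ?_⟩
      · exact absurd (h1.symm.trans h0) one_ne_zero
      · exact absurd h1 h2.2.ne
    · exact ⟨fun h0 => absurd h0 hmid.1.ne', fun h1 => absurd h1 hmid.2.ne, fun _ => hW'⟩
    · have h0 := mixedThreshold_of_gt h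
      refine ⟨fun _ => hW' ▸ hmono h.le, fun h1 => ?_, fun h2 => ?_⟩
      · exact absurd (h0.symm.trans h1) zero_ne_one
      · exact absurd h0 h2.1.ne'
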